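/- There is a universal constant $C>0$ such that the following holds. Let $n\ge 1$, let $A>0$, and let $K\subset\mathbb{R}^n$ be a nonempty bounded open convex set. For a measurable set $T\subset\mathbb{R}^n$ with $0<\mathrm{Vol}_n(T)<\infty$ write $\mu_T$ for the uniform probability measure on $T$. Assume that $K$ is isotropic, i.e. $\int_K y\,d\mu_K(y)=0$ and $\int_K\langle x,y\rangle^2\,d\mu_K(y)-\left(\int_K\langle x,y\rangle\,d\mu_K(y)\right)^2=|x|^2$ for all $x\in\mathbb{R}^n$. For $s>0$ let $K_s=K\cap sB_2^n$, where $B_2^n=\{x\in\mathbb{R}^n : |x|\le 1\}$. Suppose that $$\left|\frac{\int_{K_s}|x|^2\,d\mu_{K_s}(x)}{\int_K|x|^2\,d\mu_K(x)}-1\right|\le A$$ for every $s>0$ with $\mathrm{Vol}_n(K_s)/\mathrm{Vol}_n(K)\in[1/8,7/8]$. Then $$\int_K\left(\frac{|x|^2}{n}-1\right)^2 d\mu_K(x)\le C A^2.$$ -/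

import Mathlib

open MeasureTheory

noncomputable section

namespace ThinShell

/-- Euclidean space `ℝⁿ` with its standard scalar product, norm and Lebesgue measure. -/
abbrev E (n : ℕ) : Type := EuclideanSpace ℝ (Fin n)

/-- A convex body in `ℝⁿ` in the convention used here: a nonempty bounded open convex set. -/
structure IsOpenConvexBody {n : ℕ} (K : Set (E n)) : Prop where
  nonempty : K.Nonempty
  isOpen : IsOpen K
  convex : Convex ℝ K
  isBounded : Bornology.IsBounded K

/-- The uniform probability measure `μ_K` on `K`: Lebesgue measure restricted to `K`, divided
by the volume of `K` (a probability measure when `0 < volume K < ∞`). -/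
def uniformMeasure {n : ℕ} (K : Set (E n)) : Measure (E n) :=
  (volume K)⁻¹ • volume.restrict K

/-- The barycenter of `K`. -/
def barycenter {n : ℕ} (K : Set (E n)) : E n :=
  ∫ y, y ∂(uniformMeasure K)

/-- The quadratic form `q_K(x) = ∫ ⟨x, y⟩² dμ_K(y) - (∫ ⟨x, y⟩ dμ_K(y))²`. -/
def covForm {n : ℕ} (K : Set (E n)) (x : E n) : ℝ :=
  (∫ y, (inner ℝ x y) ^ 2 ∂(uniformMeasure K)) - (∫ y, inner ℝ x y ∂(uniformMeasure K)) ^ 2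

/-- `K` is isotropic: its barycenter is the origin and `q_K(x) = |x|²` for all `x`.
(No normalization of the volume.) -/
def IsIsotropic {n : ℕ} (K : Set (E n)) : Prop :=
  barycenter K = 0 ∧ ∀ x : E n, covForm K x = ‖x‖ ^ 2

/-- The truncation `K_s = K ∩ s B₂ⁿ`, where `B₂ⁿ` is the closed Euclidean unit ball. -/
def truncation {n : ℕ} (K : Set (E n)) (s : ℝ) : Set (E n) :=
  K ∩ Metric.closedBall 0 s

/-- The second moment `∫ |x|² dμ_K(x)`. -/
def secondMoment {n : ℕ} (K : Set (E n)) : ℝ :=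
  ∫ x, ‖x‖ ^ 2 ∂(uniformMeasure K)

end ThinShell

end

namespace ThinShell

open Set Filter Topology
open scoped ENNReal

/-! Put φ = |x|²/n. At the median radius the hypothesis gives ∫ |φ - 1| ≤ 2A. It remains to bound
the second moment of |φ - 1| by the square of its first moment, with a constant independent of n.

On each segment φ - 1 is a quadratic polynomial, so small values at three points near one end force
a moderate value at the other end. Hence on a segment from a point with |φ - 1| > 49t to one with |φ
- 1| ≤ t, at least one of two fixed intermediate points has |φ - 1| > t. A two-parameter
Prékopa–Leindler inequality turns this into p(49t) ≤ 32 p(t)³ for the tail p, once p(t) ≤ 1/2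
(`tail_cube_le`). Markov's bound M/t thus improves to O(M³/t³), which makes t p(t) integrable at
infinity (`integral_sq_le_of_tail_cube_le`).

Several parameters are possible because the transport proof on the line uses one coupling for all of
them, and the resulting inequality tensorizes. -/

/-! ### Quantile coupling and the interpolation inequality -/

theorem continuous_cdf {μ : Measure ℝ} [IsProbabilityMeasure μ] (h : ∀ x, μ {x} = 0) :
    Continuous (ProbabilityTheory.cdf μ) := by
  set Φ := ProbabilityTheory.cdf μ
  rw [continuous_iff_continuousAt]
  intro x
  rw [Φ.mono.continuousAt_iff_leftLim_eq_rightLim, Φ.rightLim_eq]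
  have h0 := h x
  rw [← ProbabilityTheory.measure_cdf μ, Φ.measure_singleton, ENNReal.ofReal_eq_zero] at h0
  exact le_antisymm (Φ.mono.leftLim_le le_rfl) (by linarith)

theorem exists_cdf_eq {μ : Measure ℝ} (h : Continuous (ProbabilityTheory.cdf μ)) {u : ℝ}
    (hu : u ∈ Ioo (0 : ℝ) 1) : ∃ x, ProbabilityTheory.cdf μ x = u := by
  obtain ⟨a, ha⟩ :=
    ((ProbabilityTheory.tendsto_cdf_atBot μ).eventually (gt_mem_nhds hu.1)).exists
  obtain ⟨b, hb⟩ :=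
    ((ProbabilityTheory.tendsto_cdf_atTop μ).eventually (lt_mem_nhds hu.2)).exists
  exact mem_range_of_exists_le_of_exists_ge h ⟨a, ha.le⟩ ⟨b, hb.le⟩

/-- The quantile function of a probability density on the line. -/
theorem exists_quantile {f : ℝ → ℝ≥0∞} (hf : Measurable f) (hf1 : ∫⁻ x, f x = 1) :
    ∃ X X' : ℝ → ℝ, StrictMonoOn X (Ioo 0 1) ∧ ∀ᵐ u ∂(volume.restrict (Ioo (0 : ℝ) 1)),
      0 < X' u ∧ HasDerivAt X (X' u) u ∧ f (X u) = ENNReal.ofReal (X' u)⁻¹ := by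
  set μ : Measure ℝ := volume.withDensity f with hμ
  have : IsProbabilityMeasure μ := ⟨by rw [hμ, withDensity_apply _ MeasurableSet.univ]; simpa⟩
  set Φ := ProbabilityTheory.cdf μ with hΦ
  have hmeas : Φ.measure = μ := ProbabilityTheory.measure_cdf μ
  have hcont : Continuous Φ := continuous_cdf fun x =>
    withDensity_absolutelyContinuous volume f (measure_singleton x)
  have hsurj : ∀ u ∈ Ioo (0 : ℝ) 1, ∃ x, Φ x = u := fun u hu => exists_cdf_eq hcont hu
  choose! X hXeq using hsurj
  have hmono : StrictMonoOn X (Ioo 0 1) := fun u hu v hv huv => by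
    by_contra! hle
    have := Φ.mono hle
    rw [hXeq u hu, hXeq v hv] at this
    linarith
  have hXm : AEMeasurable X (volume.restrict (Ioo (0 : ℝ) 1)) :=
    aemeasurable_restrict_of_monotoneOn measurableSet_Ioo hmono.monotoneOn
  have hmap : (volume.restrict (Ioo (0 : ℝ) 1)).map X = μ := by
    -- As `X` is an arbitrary choice of preimages, {X ≤ x} is determined only up to the endpoint u =
    -- Φ x, a null set.
    refine Measure.ext_of_Iic _ _ fun x => ?_
    rw [Measure.map_apply_of_aemeasurable hXm measurableSet_Iic,
      Measure.restrict_apply' measurableSet_Ioo, ← ProbabilityTheory.ofReal_cdf]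
    refine le_antisymm ?_ ?_
    · refine (measure_mono (t := Ioc 0 (Φ x)) fun u hu => ⟨hu.2.1, ?_⟩).trans (by simp [hΦ])
      rw [← hXeq u hu.2]
      exact Φ.mono hu.1
    · refine le_trans (by simp [hΦ]) (measure_mono (s := Ioo 0 (Φ x)) fun u hu => ?_)
      have hu1 : u ∈ Ioo (0 : ℝ) 1 := ⟨hu.1, hu.2.trans_le (ProbabilityTheory.cdf_le_one μ x)⟩
      refine ⟨?_, hu1⟩
      by_contra hlt
      have := Φ.mono (not_le.1 hlt).le
      rw [hXeq u hu1] at this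
      exact absurd this (not_le.2 hu.2)
  have hae : ∀ᵐ x ∂μ, HasDerivAt Φ (f x).toReal x ∧ f x < ∞ := by
    refine (withDensity_absolutelyContinuous volume f).ae_le ?_
    filter_upwards [Φ.ae_hasDerivAt, Measure.rnDeriv_withDensity volume hf,
      ae_lt_top hf (by simp [hf1])] with x h1 h2 h3
    rw [hmeas, h2] at h1
    exact ⟨h1, h3⟩
  rw [← hmap] at hae
  refine ⟨X, deriv X, hmono, ?_⟩
  filter_upwards [ae_of_ae_map hXm hae, hmono.monotoneOn.ae_differentiableWithinAt
    measurableSet_Ioo, ae_restrict_mem measurableSet_Ioo] with u h1 h2 hu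
  have hu' : Ioo (0 : ℝ) 1 ∈ 𝓝 u := isOpen_Ioo.mem_nhds hu
  have hd := (h2.differentiableAt hu').hasDerivAt
  have hprod : (f (X u)).toReal * deriv X u = 1 := by
    refine (h1.1.comp u hd).unique ((hasDerivAt_id u).congr_of_eventuallyEq ?_)
    filter_upwards [hu'] with v hv using hXeq v hv
  have hpos : 0 < deriv X u := by
    by_contra! hle
    nlinarith [ENNReal.toReal_nonneg (a := f (X u))]
  exact ⟨hpos, hd, by rw [← eq_inv_of_mul_eq_one_left hprod, ENNReal.ofReal_toReal h1.2.ne]⟩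

/-- Interpolation with several parameters along one coupling; for a single parameter this is
the Prékopa–Leindler inequality. -/
def HasInterpolationInequality (V : Type*) [AddCommGroup V] [Module ℝ V] [MeasureSpace V] : Prop :=
  ∀ (ι : Type) [Fintype ι] (θ : ι → ℝ), (∀ i, θ i ∈ Icc (0 : ℝ) 1) →
    ∀ (f g : V → ℝ≥0∞) (h : ι → V → ℝ≥0∞), Measurable f → Measurable g →
      (∀ i, Measurable (h i)) →
      ∫⁻ x, f x ≠ 0 → ∫⁻ x, f x ≠ ∞ → ∫⁻ x, g x ≠ 0 → ∫⁻ x, g x ≠ ∞ →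
      (∀ x y, f x ≠ 0 → f x ≠ ∞ → g y ≠ 0 → g y ≠ ∞ →
        1 ≤ ∑ i, h i ((1 - θ i) • x + θ i • y) / (f x ^ (1 - θ i) * g y ^ θ i)) →
      1 ≤ ∑ i, (∫⁻ z, h i z) / ((∫⁻ x, f x) ^ (1 - θ i) * (∫⁻ x, g x) ^ θ i)

/-- Weighted AM-GM for the speeds x, y of the two quantile functions: the Jacobian z of the
interpolated map dominates x^(1-θ) y^θ. -/
theorem div_le_of_geom_le {F G a b h : ℝ≥0∞} {x y z θ : ℝ} (hθ : θ ∈ Icc (0 : ℝ) 1)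
    (hx : 0 < x) (hy : 0 < y) (hz : (1 - θ) * x + θ * y = z)
    (ha : a = F * ENNReal.ofReal x⁻¹) (hb : b = G * ENNReal.ofReal y⁻¹) :
    h / (a ^ (1 - θ) * b ^ θ) ≤ ENNReal.ofReal |z| * h / (F ^ (1 - θ) * G ^ θ) := by
  have h1 : 0 ≤ 1 - θ := by linarith [hθ.2]
  have hw : 0 < x ^ (1 - θ) * y ^ θ := by positivity
  have hle : x ^ (1 - θ) * y ^ θ ≤ |z| := by
    rw [← hz]
    exact (Real.geom_mean_le_arith_mean2_weighted h1 hθ.1 hx.le hy.le (by ring)).trans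
      (le_abs_self _)
  have hab : a ^ (1 - θ) * b ^ θ =
      F ^ (1 - θ) * G ^ θ / ENNReal.ofReal (x ^ (1 - θ) * y ^ θ) := by
    rw [ha, hb, ENNReal.mul_rpow_of_nonneg _ _ h1, ENNReal.mul_rpow_of_nonneg _ _ hθ.1,
      ENNReal.ofReal_rpow_of_pos (by positivity), ENNReal.ofReal_rpow_of_pos (by positivity),
      div_eq_mul_inv, ← ENNReal.ofReal_inv_of_pos hw, mul_inv,
      ENNReal.ofReal_mul (by positivity), Real.inv_rpow hx.le, Real.inv_rpow hy.le]
    ring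
  rw [hab, div_eq_mul_inv, ENNReal.inv_div (.inl ENNReal.ofReal_ne_top)
    (.inl (by simpa using hw)), ← mul_div_assoc, mul_comm]
  gcongr

/-- The pointwise hypothesis is integrated along u ↦ (X u, Y u), a coupling independent of i; only
afterwards is each summand changed to the variable z = (1 - θ i) X + θ i Y. -/
theorem hasInterpolationInequality_real : HasInterpolationInequality ℝ := by
  intro ι _ θ hθ f g h hf hg hh hF0 hF hG0 hG H
  set F := ∫⁻ x, f x with hFdef
  set G := ∫⁻ x, g x with hGdef
  have hnorm : ∀ {k : ℝ → ℝ≥0∞} {c : ℝ≥0∞}, Measurable k → ∫⁻ x, k x = c → c ≠ 0 → c ≠ ∞ →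
      ∫⁻ x, k x / c = 1 := by
    intro k c hk hc h0 htop
    simp_rw [div_eq_mul_inv]
    rw [lintegral_mul_const _ hk, hc, ENNReal.mul_inv_cancel h0 htop]
  obtain ⟨X, X', hX, hX'⟩ := exists_quantile (hf.div_const F) (hnorm hf hFdef.symm hF0 hF)
  obtain ⟨Y, Y', hY, hY'⟩ := exists_quantile (hg.div_const G) (hnorm hg hGdef.symm hG0 hG)
  obtain ⟨s, hs, hsm, hsp⟩ := (hX'.and hY').exists_measurable_mem
  set S := s ∩ Ioo (0 : ℝ) 1 with hS
  have hSm : MeasurableSet S := hsm.inter measurableSet_Ioo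
  have hSvol : volume S = 1 := by
    rw [hS, ← Measure.restrict_apply hsm, measure_congr (eventuallyEq_univ.2 hs)]
    simp
  have hfX : ∀ u ∈ S, f (X u) = F * ENNReal.ofReal (X' u)⁻¹ := fun u hu => by
    rw [← (hsp u hu.1).1.2.2, ENNReal.mul_div_cancel hF0 hF]
  have hgY : ∀ u ∈ S, g (Y u) = G * ENNReal.ofReal (Y' u)⁻¹ := fun u hu => by
    rw [← (hsp u hu.1).2.2.2, ENNReal.mul_div_cancel hG0 hG]
  have hXm : AEMeasurable X (volume.restrict S) :=
    aemeasurable_restrict_of_monotoneOn hSm (hX.monotoneOn.mono inter_subset_right)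
  have hYm : AEMeasurable Y (volume.restrict S) :=
    aemeasurable_restrict_of_monotoneOn hSm (hY.monotoneOn.mono inter_subset_right)
  set k : ι → ℝ → ℝ≥0∞ := fun i u =>
    h i ((1 - θ i) • X u + θ i • Y u) / (f (X u) ^ (1 - θ i) * g (Y u) ^ θ i) with hk
  have hkm : ∀ i, AEMeasurable (k i) (volume.restrict S) := fun i =>
    ((hh i).comp_aemeasurable ((hXm.const_smul (1 - θ i)).add (hYm.const_smul (θ i)))).div
      (((hf.comp_aemeasurable hXm).pow_const (1 - θ i)).mul
        ((hg.comp_aemeasurable hYm).pow_const (θ i)))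
  have hone : 1 ≤ ∫⁻ u in S, ∑ i, k i u := by
    calc (1 : ℝ≥0∞) = ∫⁻ u in S, 1 := by simp [hSvol]
      _ ≤ _ := setLIntegral_mono' hSm fun u hu => by
        have hx := (hsp u hu.1).1.1
        have hy := (hsp u hu.1).2.1
        refine H (X u) (Y u) ?_ ?_ ?_ ?_
        · rw [hfX u hu]; exact mul_ne_zero hF0 (by simpa using hx)
        · rw [hfX u hu]; exact ENNReal.mul_ne_top hF ENNReal.ofReal_ne_top
        · rw [hgY u hu]; exact mul_ne_zero hG0 (by simpa using hy)
        · rw [hgY u hu]; exact ENNReal.mul_ne_top hG ENNReal.ofReal_ne_top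
  rw [lintegral_finsetSum' _ fun i _ => hkm i] at hone
  refine hone.trans (Finset.sum_le_sum fun i _ => ?_)
  have h1 : 0 ≤ 1 - θ i := by linarith [(hθ i).2]
  have hinj : InjOn (fun u => (1 - θ i) * X u + θ i * Y u) S := by
    refine StrictMonoOn.injOn fun u hu v hv huv => ?_
    have hXuv := hX hu.2 hv.2 huv
    have hYuv := hY hu.2 hv.2 huv
    have := (hθ i).1
    show (1 - θ i) * X u + θ i * Y u < (1 - θ i) * X v + θ i * Y v
    rcases h1.eq_or_lt with h0 | h0
    · rw [← h0, show θ i = 1 by linarith]; linarith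
    · nlinarith
  have hder : ∀ u ∈ S, HasDerivWithinAt (fun u => (1 - θ i) * X u + θ i * Y u)
      ((1 - θ i) * X' u + θ i * Y' u) S u := fun u hu =>
    (((hsp u hu.1).1.2.1.const_mul _).add ((hsp u hu.1).2.2.1.const_mul _)).hasDerivWithinAt
  have hc : ((F ^ (1 - θ i) * G ^ θ i)⁻¹) ≠ ∞ := by
    refine ENNReal.inv_ne_top.2 (mul_ne_zero ?_ ?_)
    · exact (ENNReal.rpow_pos (pos_iff_ne_zero.2 hF0) hF).ne'
    · exact (ENNReal.rpow_pos (pos_iff_ne_zero.2 hG0) hG).ne'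
  calc ∫⁻ u in S, k i u
      ≤ ∫⁻ u in S, ENNReal.ofReal |(1 - θ i) * X' u + θ i * Y' u| *
          h i ((1 - θ i) * X u + θ i * Y u) / (F ^ (1 - θ i) * G ^ θ i) :=
        setLIntegral_mono' hSm fun u hu =>
          div_le_of_geom_le (hθ i) (hsp u hu.1).1.1 (hsp u hu.1).2.1 rfl (hfX u hu) (hgY u hu)
    _ = (∫⁻ z in (fun u => (1 - θ i) * X u + θ i * Y u) '' S, h i z) /
          (F ^ (1 - θ i) * G ^ θ i) := by
        rw [lintegral_image_eq_lintegral_abs_deriv_mul hSm hder hinj]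
        simp_rw [div_eq_mul_inv]
        rw [lintegral_mul_const' _ _ hc]
    _ ≤ _ := ENNReal.div_le_div_right (setLIntegral_le_lintegral _ _) _

/-- The inequality on the fibres has the same form as the pointwise hypothesis on the marginals, so
it can be fed back in. -/
theorem HasInterpolationInequality.prod {V W : Type*} [AddCommGroup V] [Module ℝ V]
    [MeasureSpace V] [AddCommGroup W] [Module ℝ W] [MeasureSpace W]
    [SFinite (volume : Measure V)] [SFinite (volume : Measure W)]
    (hV : HasInterpolationInequality V) (hW : HasInterpolationInequality W) :
    HasInterpolationInequality (V × W) := by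
  intro ι _ θ hθ f g h hf hg hh hF0 hF hG0 hG H
  have hprod : ∀ {k : V × W → ℝ≥0∞}, Measurable k → ∫⁻ z, k z = ∫⁻ x, ∫⁻ y, k (x, y) :=
    fun hk => lintegral_prod _ hk.aemeasurable
  simp_rw [hprod (hh _)]
  rw [hprod hf] at *
  rw [hprod hg] at *
  refine hV ι θ hθ _ _ _ hf.lintegral_prod_right' hg.lintegral_prod_right'
    (fun i => (hh i).lintegral_prod_right') hF0 hF hG0 hG fun x y h1 h2 h3 h4 => ?_
  refine hW ι θ hθ (fun w => f (x, w)) (fun w => g (y, w)) (fun i w => h i (_, w))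
    (hf.comp measurable_prodMk_left) (hg.comp measurable_prodMk_left)
    (fun i => (hh i).comp measurable_prodMk_left) h1 h2 h3 h4 fun u v h5 h6 h7 h8 => ?_
  exact H (x, u) (y, v) h5 h6 h7 h8

theorem HasInterpolationInequality.of_linearEquiv {V W : Type*} [AddCommGroup V] [Module ℝ V]
    [MeasureSpace V] [AddCommGroup W] [Module ℝ W] [MeasureSpace W]
    (hV : HasInterpolationInequality V) (e : V ≃ₗ[ℝ] W)
    (he : MeasurePreserving e volume volume) (he' : MeasurableEmbedding e) :
    HasInterpolationInequality W := by
  intro ι _ θ hθ f g h hf hg hh hF0 hF hG0 hG H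
  simp_rw [← he.lintegral_comp_emb he'] at *
  refine hV ι θ hθ _ _ _ (hf.comp he.measurable) (hg.comp he.measurable)
    (fun i => (hh i).comp he.measurable) hF0 hF hG0 hG fun x y h1 h2 h3 h4 => ?_
  simpa using H (e x) (e y) h1 h2 h3 h4

theorem hasInterpolationInequality_pi (n : ℕ) : HasInterpolationInequality (Fin n → ℝ) := by
  induction n with
  | zero =>
    intro ι _ θ hθ f g h hf hg hh hF0 hF hG0 hG H
    have hint : ∀ k : (Fin 0 → ℝ) → ℝ≥0∞, ∫⁻ x, k x = k 0 := fun k => by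
      rw [lintegral_unique, volume_pi, Measure.pi_univ, Finset.univ_eq_empty, Finset.prod_empty,
        mul_one]
      exact congrArg k (Subsingleton.elim _ _)
    simp_rw [hint] at *
    simpa using H 0 0 hF0 hF hG0 hG
  | succ n ih =>
    have hp := volume_preserving_piFinSuccAbove (fun _ : Fin (n + 1) => ℝ) 0
    have heq : ⇑(Fin.consLinearEquiv ℝ (fun _ : Fin (n + 1) => ℝ)) =
        ⇑(MeasurableEquiv.piFinSuccAbove (fun _ : Fin (n + 1) => ℝ) 0).symm := by
      ext x i
      refine Fin.cases ?_ (fun j => ?_) i <;> simp [MeasurableEquiv.piFinSuccAbove]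
    refine (hasInterpolationInequality_real.prod ih).of_linearEquiv
      (Fin.consLinearEquiv ℝ (fun _ : Fin (n + 1) => ℝ)) ?_ ?_
    · exact heq ▸ hp.symm
    · exact heq ▸ (MeasurableEquiv.measurableEmbedding _)

theorem hasInterpolationInequality_euclideanSpace (n : ℕ) : HasInterpolationInequality (E n) :=
  (hasInterpolationInequality_pi n).of_linearEquiv (WithLp.linearEquiv 2 ℝ (Fin n → ℝ)).symm
    (EuclideanSpace.volume_preserving_symm_measurableEquiv_toLp (Fin n)).symm
    (MeasurableEquiv.toLp 2 (Fin n → ℝ)).measurableEmbedding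

/-! ### Tails of a quadratic function on a convex body -/

/-- Interpolating indicators with θ = 5/6, 2/3 bounds 1 by a sum of two ratios. Since vol A ≤ vol B,
both denominators are at least vol(A)^(1/3) vol(B)^(2/3); cubing gives the claim. -/
theorem measureReal_mul_sq_le {n : ℕ} {A B D : Set (E n)} (hA : MeasurableSet A)
    (hB : MeasurableSet B) (hD : MeasurableSet D) (hAf : volume A ≠ ∞) (hBf : volume B ≠ ∞)
    (hDf : volume D ≠ ∞) (hAB : volume.real A ≤ volume.real B)
    (H : ∀ x ∈ A, ∀ y ∈ B, (1 / 6 : ℝ) • x + (5 / 6 : ℝ) • y ∈ D ∨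
      (1 / 3 : ℝ) • x + (2 / 3 : ℝ) • y ∈ D) :
    volume.real A * volume.real B ^ 2 ≤ 8 * volume.real D ^ 3 := by
  rcases (measureReal_nonneg (μ := volume) (s := A)).eq_or_lt with h0 | ha
  · rw [← h0, zero_mul]; positivity
  have hb := ha.trans_le hAB
  have key := hasInterpolationInequality_euclideanSpace n (Fin 2) ![5 / 6, 2 / 3]
    (by intro i; fin_cases i <;> norm_num)
    (A.indicator 1) (B.indicator 1) (fun _ => D.indicator 1)
    (measurable_one.indicator hA) (measurable_one.indicator hB)
    (fun _ => measurable_one.indicator hD)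
    (by rw [lintegral_indicator_one hA]; exact (ENNReal.toReal_pos_iff.1 ha).1.ne')
    (by rwa [lintegral_indicator_one hA])
    (by rw [lintegral_indicator_one hB]; exact (ENNReal.toReal_pos_iff.1 hb).1.ne')
    (by rwa [lintegral_indicator_one hB]) ?_
  · rw [lintegral_indicator_one hA, lintegral_indicator_one hB, lintegral_indicator_one hD,
      ← ofReal_measureReal hAf, ← ofReal_measureReal hBf, ← ofReal_measureReal hDf] at key
    set a := volume.real A
    set b := volume.real B
    set d := volume.real D
    have hd : 0 ≤ d := measureReal_nonneg
    simp only [Fin.sum_univ_two, Matrix.cons_val_zero, Matrix.cons_val_one,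
      ENNReal.ofReal_rpow_of_pos ha, ENNReal.ofReal_rpow_of_pos hb] at key
    rw [← ENNReal.ofReal_mul (by positivity), ← ENNReal.ofReal_mul (by positivity),
      ← ENNReal.ofReal_div_of_pos (by positivity), ← ENNReal.ofReal_div_of_pos (by positivity),
      ← ENNReal.ofReal_add (by positivity) (by positivity), ENNReal.one_le_ofReal] at key
    norm_num at key
    have hw : a ^ (1 / 3 : ℝ) * b ^ (2 / 3 : ℝ) ≤ a ^ (1 / 6 : ℝ) * b ^ (5 / 6 : ℝ) := by
      have h1 : a ^ (1 / 3 : ℝ) = a ^ (1 / 6 : ℝ) * a ^ (1 / 6 : ℝ) := by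
        rw [← Real.rpow_add ha]; norm_num
      have h2 : b ^ (5 / 6 : ℝ) = b ^ (1 / 6 : ℝ) * b ^ (2 / 3 : ℝ) := by
        rw [← Real.rpow_add hb]; norm_num
      rw [h1, h2, mul_assoc]
      gcongr
    set w := a ^ (1 / 3 : ℝ) * b ^ (2 / 3 : ℝ) with hwdef
    have hw0 : 0 < w := by positivity
    have h2 : w ≤ 2 * d := by
      have : d / (a ^ (1 / 6 : ℝ) * b ^ (5 / 6 : ℝ)) ≤ d / w := by gcongr
      have h3 : 1 ≤ 2 * d / w := by rw [mul_div_assoc]; linarith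
      rwa [one_le_div hw0] at h3
    have h3 : w ^ 3 = a * b ^ 2 := by
      rw [hwdef, mul_pow, ← Real.rpow_mul_natCast ha.le, ← Real.rpow_mul_natCast hb.le]
      norm_num
    calc a * b ^ 2 = w ^ 3 := h3.symm
      _ ≤ (2 * d) ^ 3 := by gcongr
      _ = 8 * d ^ 3 := by ring
  · intro x y hx _ hy _
    have hxA : x ∈ A := by by_contra h; simp [h] at hx
    have hyB : y ∈ B := by by_contra h; simp [h] at hy
    have hD' := H x hxA y hyB
    simp only [Fin.sum_univ_two, Matrix.cons_val_zero, Matrix.cons_val_one]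
    rw [show (1 - 5 / 6 : ℝ) = 1 / 6 by norm_num, show (1 - 2 / 3 : ℝ) = 1 / 3 by norm_num]
    simp only [hxA, hyB, indicator_of_mem, Pi.one_apply, ENNReal.one_rpow, mul_one, div_one]
    rcases hD' with h | h <;> rw [indicator_of_mem h, Pi.one_apply]
    exacts [le_self_add, le_add_self]

theorem tail_cube_le {n : ℕ} {K : Set (E n)} (hK : IsOpenConvexBody K) (c d : ℝ) {t : ℝ}
    (ht : volume.real (K ∩ {x | t < |c * ‖x‖ ^ 2 + d|}) ≤ volume.real K / 2) :
    volume.real (K ∩ {x | 49 * t < |c * ‖x‖ ^ 2 + d|}) * volume.real K ^ 2 ≤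
      32 * volume.real (K ∩ {x | t < |c * ‖x‖ ^ 2 + d|}) ^ 3 := by
  have hcont : Continuous fun x : E n => |c * ‖x‖ ^ 2 + d| := by fun_prop
  have hfin : ∀ s ⊆ K, volume s ≠ ∞ := fun s hs => (hK.isBounded.subset hs).measure_lt_top.ne
  have hKm := hK.isOpen.measurableSet
  set D := K ∩ {x | t < |c * ‖x‖ ^ 2 + d|}
  set A := K ∩ {x | 49 * t < |c * ‖x‖ ^ 2 + d|}
  have hDm : MeasurableSet D := hKm.inter (measurableSet_lt measurable_const hcont.measurable)
  have hAm : MeasurableSet A := hKm.inter (measurableSet_lt measurable_const hcont.measurable)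
  have hDK : D ⊆ K := inter_subset_left
  have hKD : volume.real (K \ D) = volume.real K - volume.real D :=
    measureReal_sdiff hDK hDm (hfin K subset_rfl)
  rcases lt_or_ge t 0 with ht0 | ht0
  -- For negative t the tail is all of K, so `ht` forces zero volume.
  · have : D = K := by
      refine inter_eq_left.2 fun x _ => ht0.trans_le (abs_nonneg _)
    rw [this] at ht ⊢
    have h0 : volume.real K = 0 := by linarith [measureReal_nonneg (μ := volume) (s := K)]
    simp [h0]
  have hAD : A ⊆ D := fun x hx =>
    ⟨hx.1, (show t ≤ 49 * t by linarith).trans_lt hx.2⟩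
  have hle : volume.real A ≤ volume.real D := measureReal_mono hAD (hfin D hDK)
  have key := measureReal_mul_sq_le hAm (hKm.diff hDm) hDm (hfin A inter_subset_left)
    (hfin _ sdiff_subset) (hfin D hDK) (by linarith) fun x hx y hy => by
      have hyt : |c * ‖y‖ ^ 2 + d| ≤ t := by
        by_contra! h
        exact hy.2 ⟨hy.1, h⟩
      by_contra! hcon
      have hz : ∀ p q : ℝ, 0 ≤ p → 0 ≤ q → p + q = 1 → p • x + q • y ∉ D →
          |c * (p ^ 2 * ‖x‖ ^ 2 + 2 * (p * q * inner ℝ x y) + q ^ 2 * ‖y‖ ^ 2) + d| ≤ t := by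
        intro p q hp hq hpq hn
        by_contra! h
        refine hn ⟨hK.convex hx.1 hy.1 hp hq hpq, ?_⟩
        show t < |c * ‖p • x + q • y‖ ^ 2 + d|
        have hsq : ‖p • x + q • y‖ ^ 2 =
            p ^ 2 * ‖x‖ ^ 2 + 2 * (p * q * inner ℝ x y) + q ^ 2 * ‖y‖ ^ 2 := by
          rw [norm_add_sq_real, norm_smul, norm_smul, real_inner_smul_left,
            real_inner_smul_right, Real.norm_of_nonneg hp, Real.norm_of_nonneg hq]
          ring
        rwa [hsq]
      have h1 := abs_le.1 (hz _ _ (by norm_num) (by norm_num) (by norm_num) hcon.1)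
      have h2 := abs_le.1 (hz _ _ (by norm_num) (by norm_num) (by norm_num) hcon.2)
      have h3 := abs_le.1 hyt
      -- Lagrange extrapolation from the nodes 0, 1/6, 1/3 to 1 has coefficients 10, -24, 15, and 10
      -- + 24 + 15 = 49.
      have h4 : |c * ‖x‖ ^ 2 + d| ≤ 49 * t := by
        rw [abs_le]
        constructor <;> linarith [h1.1, h1.2, h2.1, h2.2, h3.1, h3.2]
      exact absurd hx.2 (not_lt.2 h4)
  have h5 : volume.real K / 2 ≤ volume.real (K \ D) := by linarith
  have h6 : (volume.real K / 2) ^ 2 ≤ volume.real (K \ D) ^ 2 :=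
    pow_le_pow_left₀ (by positivity) h5 2
  have := mul_le_mul_of_nonneg_left h6 (measureReal_nonneg (μ := volume) (s := A))
  linarith

theorem integral_sq_le_of_tail_cube_le {Ω : Type*} [MeasurableSpace Ω] (μ : Measure Ω)
    [IsProbabilityMeasure μ] {φ : Ω → ℝ} (hφ : Integrable φ μ) (h0 : 0 ≤ φ) {M : ℝ} (hM : 0 < M)
    (hφM : ∫ x, φ x ∂μ ≤ M)
    (htail : ∀ t, μ.real {x | t < φ x} ≤ 1 / 2 →
      μ.real {x | 49 * t < φ x} ≤ 32 * μ.real {x | t < φ x} ^ 3) :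
    ∫ x, φ x ^ 2 ∂μ ≤ 96040 * M ^ 2 := by
  have hmarkov : ∀ t, 0 < t → μ.real {x | t < φ x} ≤ M / t := fun t ht => by
    rw [le_div_iff₀ ht, mul_comm]
    refine le_trans ?_ ((mul_meas_ge_le_integral_of_nonneg (ae_of_all _ h0) hφ t).trans hφM)
    exact mul_le_mul_of_nonneg_left (measureReal_mono fun x (hx : t < φ x) => hx.le) ht.le
  -- The threshold 98M = 49 · 2M makes Markov's bound at u/49 at most 1/2.
  have hp : ∀ u, 98 * M < u → μ.real {x | u < φ x} ≤ 32 * 49 ^ 3 * M ^ 3 * u⁻¹ ^ 3 := by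
    intro u hu
    have hu0 : 0 < u := by linarith
    have h1 := hmarkov (u / 49) (by positivity)
    have h2 : M / (u / 49) ≤ 1 / 2 := by
      rw [div_le_iff₀ (by positivity)]; linarith
    have h3 := htail (u / 49) (h1.trans h2)
    rw [mul_div_cancel₀ _ (by norm_num : (49 : ℝ) ≠ 0)] at h3
    calc _ ≤ 32 * μ.real {x | u / 49 < φ x} ^ 3 := h3
      _ ≤ 32 * (M / (u / 49)) ^ 3 := by gcongr
      _ = _ := by field_simp
  have hlin : ∫⁻ x, ENNReal.ofReal (φ x ^ 2) ∂μ ≤ ENNReal.ofReal (96040 * M ^ 2) := by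
    have hlc := lintegral_rpow_eq_lintegral_meas_lt_mul μ (ae_of_all _ h0) hφ.aemeasurable
      (p := 2) (by norm_num)
    norm_num at hlc
    -- In the layer-cake integral the tail is bounded by 1 up to 98M and by `hp` beyond.
    rw [hlc, ← Ioc_union_Ioi_eq_Ioi (show (0 : ℝ) ≤ 98 * M by positivity),
      lintegral_union measurableSet_Ioi (Ioc_disjoint_Ioi le_rfl)]
    have hI : ∫⁻ t in Ioc 0 (98 * M), μ {a | t < φ a} * ENNReal.ofReal t ≤
        ENNReal.ofReal (98 * M * (98 * M)) := by
      calc _ ≤ ∫⁻ t in Ioc 0 (98 * M), ENNReal.ofReal (98 * M) :=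
            setLIntegral_mono' measurableSet_Ioc fun t ht => by
              calc _ ≤ 1 * ENNReal.ofReal t := by gcongr; exact prob_le_one
                _ ≤ _ := by rw [one_mul]; exact ENNReal.ofReal_le_ofReal ht.2
        _ = _ := by
          rw [setLIntegral_const, Real.volume_Ioc, ← ENNReal.ofReal_mul (by positivity), sub_zero]
    have hII : ∫⁻ t in Ioi (98 * M), μ {a | t < φ a} * ENNReal.ofReal t ≤
        ENNReal.ofReal (32 * 49 ^ 3 * M ^ 3 * (98 * M)⁻¹) := by
      have hc : 0 < 98 * M := by positivity
      calc _ ≤ ∫⁻ t in Ioi (98 * M), ENNReal.ofReal (32 * 49 ^ 3 * M ^ 3 * t ^ (-2 : ℝ)) :=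
            setLIntegral_mono' measurableSet_Ioi fun t ht => by
              have ht0 : 0 < t := hc.trans ht
              rw [← ofReal_measureReal, ← ENNReal.ofReal_mul measureReal_nonneg]
              refine ENNReal.ofReal_le_ofReal ?_
              calc _ ≤ 32 * 49 ^ 3 * M ^ 3 * t⁻¹ ^ 3 * t := by gcongr; exact hp t ht
                _ = _ := by
                  rw [Real.rpow_neg ht0.le]
                  norm_num
                  field_simp
        _ = ENNReal.ofReal (∫ t in Ioi (98 * M), 32 * 49 ^ 3 * M ^ 3 * t ^ (-2 : ℝ)) := by
            rw [ofReal_integral_eq_lintegral_ofReal]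
            · exact (integrableOn_Ioi_rpow_of_lt (by norm_num) hc).const_mul _
            · filter_upwards [ae_restrict_mem measurableSet_Ioi] with t ht
              have : 0 < t := hc.trans ht
              positivity
        _ ≤ _ := by
            rw [integral_const_mul, integral_Ioi_rpow_of_lt (by norm_num) hc]
            norm_num [Real.rpow_neg_one]
    calc _ ≤ 2 * (ENNReal.ofReal (98 * M * (98 * M)) +
          ENNReal.ofReal (32 * 49 ^ 3 * M ^ 3 * (98 * M)⁻¹)) := by gcongr
      _ = ENNReal.ofReal (96040 * M ^ 2) := by
        rw [← ENNReal.ofReal_add (by positivity) (by positivity),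
          show (2 : ℝ≥0∞) = ENNReal.ofReal 2 by simp, ← ENNReal.ofReal_mul (by norm_num)]
        congr 1
        field_simp
        norm_num
  rw [integral_eq_lintegral_of_nonneg_ae (ae_of_all _ fun x => sq_nonneg _)
    (hφ.aestronglyMeasurable.pow 2)]
  exact ENNReal.toReal_le_of_le_ofReal (by positivity) hlin

/-! ### Uniform measure, isotropy and the median radius -/

theorem integral_uniformMeasure {n : ℕ} (K : Set (E n)) {F : Type*} [NormedAddCommGroup F]
    [NormedSpace ℝ F] (φ : E n → F) :
    ∫ x, φ x ∂(uniformMeasure K) = (volume.real K)⁻¹ • ∫ x in K, φ x := by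
  rw [uniformMeasure, integral_smul_measure, ENNReal.toReal_inv, measureReal_def]

namespace IsOpenConvexBody

variable {n : ℕ} {K : Set (E n)}

theorem measureReal_pos (hK : IsOpenConvexBody K) : 0 < volume.real K :=
  ENNReal.toReal_pos (hK.isOpen.measure_pos volume hK.nonempty).ne'
    hK.isBounded.measure_lt_top.ne

theorem isProbabilityMeasure (hK : IsOpenConvexBody K) :
    IsProbabilityMeasure (uniformMeasure K) := by
  refine ⟨?_⟩
  rw [uniformMeasure, Measure.smul_apply, Measure.restrict_apply_univ, smul_eq_mul,
    ENNReal.inv_mul_cancel (hK.isOpen.measure_pos volume hK.nonempty).ne'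
      hK.isBounded.measure_lt_top.ne]

theorem measureReal_uniformMeasure (hK : IsOpenConvexBody K) (s : Set (E n)) :
    (uniformMeasure K).real s = volume.real (K ∩ s) / volume.real K := by
  rw [uniformMeasure, measureReal_ennreal_smul_apply,
    measureReal_restrict_apply' hK.isOpen.measurableSet, inter_comm, ENNReal.toReal_inv,
    measureReal_def volume K, div_eq_inv_mul]

theorem integrable (hK : IsOpenConvexBody K) {F : Type*} [NormedAddCommGroup F]
    {φ : E n → F} (hφ : Continuous φ) : Integrable φ (uniformMeasure K) := by
  refine Integrable.smul_measure ?_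
    (ENNReal.inv_ne_top.2 (hK.isOpen.measure_pos volume hK.nonempty).ne')
  exact (hφ.continuousOn.integrableOn_compact hK.isBounded.isCompact_closure).mono_set
    subset_closure

theorem secondMoment_eq (hK : IsOpenConvexBody K) (hiso : IsIsotropic K) :
    secondMoment K = n := by
  have hcoord : ∀ i, ∫ y, (y i) ^ 2 ∂(uniformMeasure K) = 1 := fun i => by
    have h := hiso.2 (EuclideanSpace.single i 1)
    have h0 : ∫ y, inner ℝ (EuclideanSpace.single i (1 : ℝ)) y ∂(uniformMeasure K) = 0 := by
      have := hiso.1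
      rw [barycenter] at this
      rw [integral_inner (f := fun y => y) (hK.integrable continuous_id), this, inner_zero_right]
    rw [covForm, h0] at h
    simpa [EuclideanSpace.inner_single_left] using h
  rw [secondMoment]
  simp_rw [EuclideanSpace.real_norm_sq_eq]
  rw [integral_finsetSum _ fun i _ => hK.integrable (by fun_prop)]
  simp [hcoord]

/-- Spheres are null, so the law of |x| has a continuous distribution function. -/
theorem exists_measureReal_truncation_eq_half (hK : IsOpenConvexBody K) (hn : 1 ≤ n) :
    ∃ s : ℝ, 0 < s ∧ volume.real (truncation K s) / volume.real K = 1 / 2 := by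
  have := hK.isProbabilityMeasure
  have : Nonempty (Fin n) := ⟨⟨0, hn⟩⟩
  set ν := (uniformMeasure K).map fun x => ‖x‖ with hν
  have : IsProbabilityMeasure ν := Measure.isProbabilityMeasure_map (by fun_prop)
  have hcont : Continuous (ProbabilityTheory.cdf ν) := continuous_cdf fun r => by
    rw [hν, Measure.map_apply measurable_norm (measurableSet_singleton r)]
    have : (fun x : E n => ‖x‖) ⁻¹' {r} = Metric.sphere 0 r := by ext; simp
    rw [this, uniformMeasure, Measure.smul_apply,
      Measure.restrict_apply Metric.isClosed_sphere.measurableSet,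
      measure_mono_null inter_subset_left (Measure.addHaar_sphere volume 0 r), smul_zero]
  have hcdf : ∀ r, ProbabilityTheory.cdf ν r =
      volume.real (truncation K r) / volume.real K := fun r => by
    rw [ProbabilityTheory.cdf_eq_real, hν, map_measureReal_apply measurable_norm measurableSet_Iic,
      hK.measureReal_uniformMeasure, truncation]
    congr 3
    ext; simp
  obtain ⟨s, hs⟩ := exists_cdf_eq hcont (u := 1 / 2) (by norm_num)
  refine ⟨s, ?_, hcdf s ▸ hs⟩
  by_contra! hs0
  have : volume.real (truncation K s) = 0 := by
    have h0 : volume (truncation K s) = 0 := by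
      refine measure_mono_null (t := {0}) (fun x hx => ?_) (measure_singleton 0)
      have := mem_closedBall_zero_iff.1 hx.2
      simpa using this.trans hs0
    rw [measureReal_def, h0, ENNReal.toReal_zero]
  rw [hcdf, this] at hs
  norm_num at hs

end IsOpenConvexBody

/-- Around a median m the constants cancel: ∫ |φ - m| = 1 - 2 ∫_L φ ≤ A. This also bounds |1 - m|,
and the triangle inequality doubles A. -/
theorem integral_abs_sub_mean_le {Ω : Type*} [MeasurableSpace Ω] (μ : Measure Ω)
    [IsProbabilityMeasure μ] {φ : Ω → ℝ} (hφ : Integrable φ μ) (hmean : ∫ x, φ x ∂μ = 1)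
    {m A : ℝ} {L : Set Ω} (hL : MeasurableSet L) (hLm : ∀ x, x ∈ L ↔ φ x ≤ m)
    (hhalf : μ.real L = 1 / 2) (hA : |2 * ∫ x in L, φ x ∂μ - 1| ≤ A) :
    ∫ x, |φ x - 1| ∂μ ≤ 2 * A := by
  have hc : ∀ c : ℝ, Integrable (fun x => φ x - c) μ := fun c => hφ.sub (integrable_const c)
  have hcint : ∀ c : ℝ, ∫ x, (φ x - c) ∂μ = 1 - c := fun c => by
    rw [integral_sub hφ (integrable_const c), hmean]; simp
  have hind : Integrable (L.indicator fun x => φ x - m) μ := (hc m).indicator hL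
  have habs : ∀ x, |φ x - m| = (φ x - m) - 2 * L.indicator (fun x => φ x - m) x := fun x => by
    by_cases hx : x ∈ L
    · rw [indicator_of_mem hx, abs_of_nonpos (by linarith [(hLm x).1 hx])]; ring
    · rw [indicator_of_notMem hx, abs_of_nonneg (by linarith [not_le.1 (mt (hLm x).2 hx)])]; ring
  have hm : ∫ x, |φ x - m| ∂μ ≤ A := by
    simp_rw [habs]
    rw [integral_sub (hc m) (hind.const_mul 2), integral_const_mul, integral_indicator hL,
      integral_sub hφ.integrableOn (integrable_const m), hcint, setIntegral_const, hhalf]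
    have := (abs_le.1 hA).1
    simp only [smul_eq_mul]
    linarith
  have h1m : |1 - m| ≤ A := by
    rw [← hcint m]
    exact (abs_integral_le_integral_abs).trans hm
  calc ∫ x, |φ x - 1| ∂μ ≤ ∫ x, (|φ x - m| + |1 - m|) ∂μ := by
        refine integral_mono (hc 1).abs ((hc m).abs.add (integrable_const _)) fun x => ?_
        have := abs_sub_le (φ x) m 1
        rwa [abs_sub_comm m 1] at this
    _ = ∫ x, |φ x - m| ∂μ + |1 - m| := by
        rw [integral_add (hc m).abs (integrable_const _)]; simp
    _ ≤ 2 * A := by linarith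

theorem IsOpenConvexBody.integral_abs_le {n : ℕ} (hn : 1 ≤ n) {A : ℝ} {K : Set (E n)}
    (hK : IsOpenConvexBody K) (hiso : IsIsotropic K)
    (H : ∀ s : ℝ, 0 < s →
      volume.real (truncation K s) / volume.real K ∈ Set.Icc (1 / 8 : ℝ) (7 / 8) →
      |secondMoment (truncation K s) / secondMoment K - 1| ≤ A) :
    ∫ x, |‖x‖ ^ 2 / (n : ℝ) - 1| ∂(uniformMeasure K) ≤ 2 * A := by
  have := hK.isProbabilityMeasure
  have hn0 : (0 : ℝ) < n := by exact_mod_cast hn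
  obtain ⟨s, hs, hhalf⟩ := hK.exists_measureReal_truncation_eq_half hn
  have hA := H s hs (by rw [hhalf]; norm_num)
  have hV := hK.measureReal_pos
  have hsm := hK.secondMoment_eq hiso
  refine integral_abs_sub_mean_le (uniformMeasure K) (hK.integrable (by fun_prop)) ?_
    (m := s ^ 2 / n) (L := Metric.closedBall 0 s) Metric.isClosed_closedBall.measurableSet
    (fun x => ?_) ?_ ?_
  · rw [integral_div, show ∫ x, ‖x‖ ^ 2 ∂(uniformMeasure K) = n from hsm, div_self hn0.ne']
  · rw [mem_closedBall_zero_iff, div_le_div_iff_of_pos_right hn0,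
      sq_le_sq₀ (norm_nonneg x) hs.le]
  · rw [hK.measureReal_uniformMeasure]; exact hhalf
  -- Halving the volume doubles the density, hence the factor 2 in front of the integral over L.
  · convert hA using 3
    rw [hsm, integral_div, secondMoment, integral_uniformMeasure]
    have hT : volume.real (truncation K s) = volume.real K / 2 := by
      field_simp at hhalf; linarith
    rw [hT, uniformMeasure, Measure.restrict_smul, integral_smul_measure, ENNReal.toReal_inv,
      ← measureReal_def, Measure.restrict_restrict Metric.isClosed_closedBall.measurableSet,
      inter_comm, truncation]
    simp only [smul_eq_mul]
    field_simp

end ThinShell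

theorem proposition6p5 :
    ∃ C : ℝ, 0 < C ∧
      ∀ (n : ℕ), 1 ≤ n →
      ∀ (A : ℝ), 0 < A →
      ∀ (K : Set (ThinShell.E n)), ThinShell.IsOpenConvexBody K → ThinShell.IsIsotropic K →
        (∀ s : ℝ, 0 < s →
          volume.real (ThinShell.truncation K s) / volume.real K ∈ Set.Icc (1 / 8 : ℝ) (7 / 8) →
          |ThinShell.secondMoment (ThinShell.truncation K s) / ThinShell.secondMoment K - 1| ≤ A) →
        ∫ x, (‖x‖ ^ 2 / (n : ℝ) - 1) ^ 2 ∂(ThinShell.uniformMeasure K) ≤ C * A ^ 2 := by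
  -- The constant is 96040 · 2², from M = 2A.
  refine ⟨384160, by norm_num, fun n hn A hA K hK hiso H => ?_⟩
  have := hK.isProbabilityMeasure
  have hV := hK.measureReal_pos
  have key := ThinShell.integral_sq_le_of_tail_cube_le (ThinShell.uniformMeasure K)
    (φ := fun x => |‖x‖ ^ 2 / (n : ℝ) - 1|) (hK.integrable (by fun_prop))
    (fun x => abs_nonneg _) (M := 2 * A) (by positivity) (hK.integral_abs_le hn hiso H)
    fun t ht => by
      have hrw : ∀ x : ThinShell.E n, ‖x‖ ^ 2 / (n : ℝ) - 1 = (n : ℝ)⁻¹ * ‖x‖ ^ 2 + (-1) :=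
        fun x => by ring
      simp only [hK.measureReal_uniformMeasure, hrw] at ht ⊢
      rw [div_le_iff₀ hV] at ht
      have := ThinShell.tail_cube_le hK (n : ℝ)⁻¹ (-1) (t := t) (by linarith)
      rw [div_pow, ← mul_div_assoc, div_le_div_iff₀ hV (by positivity)]
      nlinarith
  simp only [sq_abs] at key
  linarith
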